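/- Throughout, a cardinal is identified with the set of ordinals below its initial ordinal. For a set $A$ let $[A]^{\omega}$ be the set of countably infinite subsets of $A$. For $A\supseteq\omega_1$, a family $C$ of countable subsets of $A$ is club if every countable subset of $A$ is contained in a member of $C$ and $C$ is closed under unions of $\subseteq$-increasing sequences of nonzero length $<\omega_1$; a set $S\subseteq[A]^{\omega}$ is stationary in $[A]^\omega$ if it meets every such club $C$. A set $S\subseteq[A]^{\omega}$ is full if $y\in S$ whenever $x\in S$, $y\in[A]^\omega$, $x\subseteq y$ and $x\cap\omega_1=y\cap\omega_1$. For a cardinal $\kappa\ge\omega_2$, $\mathrm{SSR}(\kappa)$ is the statement: for every full stationary $S\subseteq[\kappa]^{\omega}$ there is $I\subseteq\kappa$ with $|I|=\omega_1$ and $\omega_1\subseteq I$ such that $S\cap[I]^{\omega}$ is stationary in $[I]^{\omega}$. Let $\vec\lambda=(\lambda_n:n<\omega)$ be a strictly increasing sequence of regular cardinals with supremum $\lambda$. For $f,g:\omega\to\mathrm{On}$ and $m<\omega$ write $f<_m g$ if $f(n)<g(n)$ for all $n\ge m$, and $f<^*g$ if $f<_m g$ for some $m$. A scale on $\vec\lambda$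 is a $<^*$-increasing sequence $(f_\beta:\beta<\lambda^+)$ of elements of $\prod_{n}\lambda_n$ such that every $g\in\prod_n\lambda_n$ satisfies $g<^*f_\beta$ for some $\beta<\lambda^+$. A scale is a better scale if for every $\alpha<\lambda^+$ of uncountable cofinality there are a closed unbounded set $C\subseteq\alpha$ and a function $\sigma:C\to\omega$ such that $f_\beta<_{\max\{\sigma(\beta),\sigma(\gamma)\}}f_\gamma$ for all $\beta<\gamma$ in $C$. **Theorem.** Let $\lambda$ be a singular cardinal of cofinality $\omega$ and assume $\mathrm{SSR}(\lambda^+)$. Then for every strictly increasing sequence $\vec\lambda=(\lambda_n:n<\omega)$ of regular cardinals converging to $\lambda$, there is no better scale on $\vec\lambda$. -/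

import Mathlib

open Cardinal Ordinal Set

universe u

/-- `[A]^{<ω₁}`: the countable subsets of `A`. -/
def countableSubsets (A : Set Ordinal.{u}) : Set (Set Ordinal.{u}) :=
  {x | x ⊆ A ∧ x.Countable}

/-- `[A]^ω`: the countably infinite subsets of `A`. -/
def omegaSubsets (A : Set Ordinal.{u}) : Set (Set Ordinal.{u}) :=
  {x | x ⊆ A ∧ x.Countable ∧ x.Infinite}

/-- `C` is club in `[A]^{<ω₁}`: it consists of countable subsets of `A`, is cofinal for inclusion,
and is closed under unions of increasing sequences of nonzero length less than `ω₁`. -/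
structure IsClubCountable (A : Set Ordinal.{u}) (C : Set (Set Ordinal.{u})) : Prop where
  subset : C ⊆ countableSubsets A
  cofinal : ∀ x ∈ countableSubsets A, ∃ y ∈ C, x ⊆ y
  closed : ∀ η : Ordinal.{u}, 0 < η → η < ω_ 1 → ∀ x : Ordinal.{u} → Set Ordinal.{u},
    (∀ ξ < η, x ξ ∈ C) → (∀ ξ ζ, ξ ≤ ζ → ζ < η → x ξ ⊆ x ζ) → (⋃ ξ ∈ Set.Iio η, x ξ) ∈ C

/-- `S`, a family of countable subsets of `A`, is stationary: it meets every club of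
`[A]^{<ω₁}`. -/
def IsStationaryCountable (A : Set Ordinal.{u}) (S : Set (Set Ordinal.{u})) : Prop :=
  S ⊆ countableSubsets A ∧ ∀ C, IsClubCountable A C → (S ∩ C).Nonempty

/-- `y` is an `ω₁`-extension of `x`. -/
def IsOmegaOneExtension (x y : Set Ordinal.{u}) : Prop :=
  x ⊆ y ∧ x ∩ Set.Iio (ω_ 1) = y ∩ Set.Iio (ω_ 1)

/-- `S ⊆ [A]^ω` is full: it is closed under `ω₁`-extensions in `[A]^ω`. -/
def IsFull (A : Set Ordinal.{u}) (S : Set (Set Ordinal.{u})) : Prop :=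
  S ⊆ omegaSubsets A ∧ ∀ x ∈ S, ∀ y ∈ omegaSubsets A, IsOmegaOneExtension x y → y ∈ S

/-- The reflection principle `SSR(κ)`; the cardinal `κ` is identified with the set of ordinals
below its initial ordinal. -/
def SSR (κ : Cardinal.{u}) : Prop :=
  ∀ S : Set (Set Ordinal.{u}), IsFull (Set.Iio κ.ord) S →
    IsStationaryCountable (Set.Iio κ.ord) S →
    ∃ I : Set Ordinal.{u}, I ⊆ Set.Iio κ.ord ∧ #I = ℵ₁ ∧ Set.Iio (ω_ 1) ⊆ I ∧
      IsStationaryCountable I (S ∩ omegaSubsets I)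

/-- `f <ₘ g`. -/
def LtFrom (m : ℕ) (f g : ℕ → Ordinal.{u}) : Prop :=
  ∀ n, m ≤ n → f n < g n

/-- `f <* g`. -/
def EventuallyLt (f g : ℕ → Ordinal.{u}) : Prop :=
  ∃ m, LtFrom m f g

/-- The product `∏ₙ lₙ`. -/
def ordProd (l : ℕ → Cardinal.{u}) : Set (ℕ → Ordinal.{u}) :=
  {g | ∀ n, g n < (l n).ord}

/-- `(f β : β < λ⁺)`, where `λ = supₙ lₙ`, is a scale on `l`: a `<*`-increasing sequence in
`∏ₙ lₙ` that is `<*`-cofinal there. Values of `f` at `β ≥ λ⁺` are irrelevant. -/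
structure IsScale (l : ℕ → Cardinal.{u}) (f : Ordinal.{u} → ℕ → Ordinal.{u}) : Prop where
  mem : ∀ β < (Order.succ (⨆ n, l n)).ord, f β ∈ ordProd l
  increasing : ∀ β γ, β < γ → γ < (Order.succ (⨆ n, l n)).ord → EventuallyLt (f β) (f γ)
  cofinal : ∀ g ∈ ordProd l, ∃ β < (Order.succ (⨆ n, l n)).ord, EventuallyLt g (f β)

/-- A better scale: for every `α < λ⁺` of uncountable cofinality there are a club `C` of `α` and
`σ : C → ω` such that `f β` is below `f γ` from `max (σ β) (σ γ)` on, for all `β < γ` in `C`. -/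
structure IsBetterScale (l : ℕ → Cardinal.{u}) (f : Ordinal.{u} → ℕ → Ordinal.{u}) : Prop
    extends IsScale l f where
  better : ∀ α < (Order.succ (⨆ n, l n)).ord, ℵ₀ < α.cof →
    ∃ (C : Set (Set.Iio α)) (σ : C → ℕ), IsClub C ∧
      ∀ β γ : C, β < γ → LtFrom (max (σ β) (σ γ)) (f β.1.1) (f γ.1.1)

/-! ### Bounds below regular cardinals -/

/-! Write κ = λ⁺ and suppose f is a better scale. Fix a ladder `i v`, increasing and cofinal of
length ω₁, for every v of cofinality ω₁. The set `ladderSets` is full, since its conditions ask for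
members of x and otherwise depend only on x ∩ ω₁. It is stationary but reflects to no I of size ℵ₁
containing ω₁, which contradicts SSR(κ).

Non-reflection (`not_isStationaryCountable_ladderSets`): enumerate I in type ω₁; almost all relevant
x are initial segments of the enumeration, so their ordinals γ, β are bounded below κ. By
`exists_isUniformWitness`, betterness makes f increasing there with uniform thresholds σ. Past these
thresholds, the order of two values f a, f b is the same at every coordinate. An even coordinate
says that γ is below β, and this must persist at the next odd coordinate. There a member of x reads
off from its ladder a countable ordinal bounding all such γ; closure of x puts it below x ∩ ω₁,
against the defining condition on the ladder.

Stationarity (`isStationaryCountable_ladderSets`): given a club, play a game of length ω building a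
generating sequence for a member x of it, while x ∩ ω₁ stays equal to δ. For some δ the builder
never has to lose (`exists_not_isLosing_nil`). The scale then supplies γ above the builder's
announced bounds and β above the replies to γ, and the opponent's moves alternate between γ and β.
-/

theorem exists_bound_of_mk_lt {c : Cardinal.{u}} (hc : c.IsRegular) {s : Set Ordinal.{u}}
    (hs : #s < Cardinal.lift.{u + 1} c) (h : ∀ a ∈ s, a < c.ord) :
    ∃ B < c.ord, ∀ a ∈ s, a ≤ B := by
  refine ⟨sSup s, Ordinal.sSup_lt_of_lt_cof ?_ h, fun a ha => ?_⟩
  · rwa [← Ordinal.lift_cof, hc.cof_ord]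
  · exact le_csSup ⟨c.ord, fun b hb => (h b hb).le⟩ ha

theorem exists_bound_of_countable {c : Cardinal.{u}} (hc : c.IsRegular) (hc₁ : ℵ₀ < c)
    {s : Set Ordinal.{u}} (hs : s.Countable) (h : ∀ a ∈ s, a < c.ord) :
    ∃ B < c.ord, ∀ a ∈ s, a ≤ B := by
  refine exists_bound_of_mk_lt hc ?_ h
  refine (Cardinal.le_aleph0_iff_set_countable.2 hs).trans_lt ?_
  simpa using hc₁

theorem exists_bound {c : Cardinal.{u}} (hc : c.IsRegular) {o : Ordinal.{u}} (ho : o < c.ord)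
    {F : Ordinal.{u} → Ordinal.{u}} (hF : ∀ i < o, F i < c.ord) :
    ∃ B < c.ord, ∀ i < o, F i ≤ B := by
  have hcard : #(F '' Iio o) < Cardinal.lift.{u + 1} c := by
    refine Cardinal.mk_image_le.trans_lt ?_
    rw [Cardinal.mk_Iio_ordinal, Cardinal.lift_lt]
    exact Cardinal.lt_ord.1 ho
  obtain ⟨B, hB, h⟩ := exists_bound_of_mk_lt hc hcard (by
    rintro _ ⟨i, hi, rfl⟩
    exact hF i hi)
  exact ⟨B, hB, fun i hi => h _ ⟨i, hi, rfl⟩⟩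

theorem countable_Iio_of_lt {δ : Ordinal.{u}} (h : δ < ω_ 1) : (Iio δ).Countable := by
  rw [← Cardinal.le_aleph0_iff_set_countable, Cardinal.mk_Iio_ordinal, Cardinal.lift_le_aleph0]
  rw [← Cardinal.ord_aleph, Cardinal.lt_ord, ← Cardinal.succ_aleph0, Order.lt_succ_iff] at h
  exact h

theorem exists_bound_lt_omega_one {s : Set Ordinal.{u}} (hs : s.Countable)
    (h : ∀ a ∈ s, a < ω_ 1) : ∃ B < ω_ 1, ∀ a ∈ s, a ≤ B := by
  rw [← Cardinal.ord_aleph] at h ⊢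
  exact exists_bound_of_countable isRegular_aleph_one aleph0_lt_aleph_one hs h

theorem add_one_lt_omega_one {a : Ordinal.{u}} (h : a < ω_ 1) : a + 1 < ω_ 1 :=
  (Cardinal.isSuccLimit_omega 1).add_one_lt h

theorem add_one_lt_ord {c : Cardinal.{u}} (hc : c.IsRegular) {a : Ordinal.{u}} (h : a < c.ord) :
    a + 1 < c.ord :=
  (Cardinal.isSuccLimit_ord hc.1).add_one_lt h

/-! ### Cofinal `ω₁`-sequences -/

/-- `g` is a strictly increasing `ω₁`-sequence cofinal in `v`. -/
def IsOmegaOneCofinal (g : Ordinal.{u} → Ordinal.{u}) (v : Ordinal.{u}) : Prop :=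
  (∀ ξ ζ, ξ < ζ → ζ < ω_ 1 → g ξ < g ζ) ∧ (∀ ξ < ω_ 1, g ξ < v) ∧ ∀ w < v, ∃ ξ < ω_ 1, w < g ξ

theorem exists_ladder : ∃ i : Ordinal.{u} → Ordinal.{u} → Ordinal.{u},
    ∀ v, (∃ g, IsOmegaOneCofinal g v) → IsOmegaOneCofinal (i v) v := by
  classical
  refine ⟨fun v => if h : ∃ g, IsOmegaOneCofinal g v then h.choose else id, fun v h => ?_⟩
  simp only [dif_pos h]
  exact h.choose_spec

theorem IsOmegaOneCofinal.exists_bound {g : Ordinal.{u} → Ordinal.{u}} {v : Ordinal.{u}}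
    (h : IsOmegaOneCofinal g v) {δ : Ordinal.{u}} (hδ : δ < ω_ 1) :
    ∃ t < v, ∀ ξ < δ, g ξ ≤ t :=
  ⟨g δ, h.2.1 δ hδ, fun ξ hξ => (h.1 ξ δ hξ hδ).le⟩

/-- The transfinite iteration of `H`, with value at `ξ` the supremum of `H` over earlier values. -/
noncomputable def iterSup (H : Ordinal.{u} → Ordinal.{u}) (ξ : Ordinal.{u}) : Ordinal.{u} :=
  ⨆ a : Iio ξ, H (iterSup H a.1)
termination_by ξ
decreasing_by exact a.2

theorem le_iterSup (H : Ordinal.{u} → Ordinal.{u}) {a ξ : Ordinal.{u}} (h : a < ξ) :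
    H (iterSup H a) ≤ iterSup H ξ := by
  rw [iterSup.eq_1 H ξ]
  exact Ordinal.le_iSup (fun a : Iio ξ => H (iterSup H a.1)) ⟨a, h⟩

theorem iterSup_lt {c : Cardinal.{u}} (hc : c.IsRegular) {H : Ordinal.{u} → Ordinal.{u}}
    (hH : ∀ t < c.ord, H t < c.ord) {ξ : Ordinal.{u}} (hξ : ξ < c.ord) : iterSup H ξ < c.ord := by
  induction ξ using WellFoundedLT.induction with
  | ind ξ ih =>
    obtain ⟨B, hB, hle⟩ := exists_bound hc hξ (F := fun a => H (iterSup H a))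
      fun a ha => hH _ (ih a ha (ha.trans hξ))
    rw [iterSup.eq_1]
    exact (Ordinal.iSup_le fun a : Iio ξ => hle a.1 a.2).trans_lt hB

/-- Iterate ω₁ times a function dominating `H` on initial segments; the limit is closed under `H`
and has cofinality ω₁. -/
theorem exists_isOmegaOneCofinal_closed {c : Cardinal.{u}} (hc : c.IsRegular) (hc₁ : ℵ₁ < c)
    {H : Ordinal.{u} → Ordinal.{u}} (hH : ∀ t < c.ord, H t < c.ord) :
    ∃ v < c.ord, (∃ g, IsOmegaOneCofinal g v) ∧ ∀ t < v, H t ≤ v := by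
  have hbd : ∀ p < c.ord, ∃ B < c.ord, p < B ∧ ∀ t ≤ p, H t ≤ B := by
    intro p hp
    obtain ⟨B, hB, hle⟩ := exists_bound hc (add_one_lt_ord hc hp) (F := H)
      fun a ha => hH a (ha.trans (add_one_lt_ord hc hp))
    refine ⟨max B (p + 1), max_lt hB (add_one_lt_ord hc hp), ?_, fun t ht => ?_⟩
    · exact lt_max_of_lt_right (lt_add_one p)
    · exact (hle t (Order.lt_add_one_iff.2 ht)).trans (le_max_left _ _)
  choose! H' hH' hlt hle using hbd
  have hω : ω_ 1 < c.ord := by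
    rw [← Cardinal.ord_aleph]
    exact Cardinal.ord_lt_ord.2 hc₁
  have hq : ∀ ξ < c.ord, iterSup H' ξ < c.ord := fun ξ hξ => iterSup_lt hc hH' hξ
  have hstep : ∀ a ξ, a < ξ → ξ < c.ord → iterSup H' a < iterSup H' ξ := fun a ξ h hξ =>
    (hlt _ (hq _ (h.trans hξ))).trans_le (le_iterSup H' h)
  have hsup : ∀ w < iterSup H' (ω_ 1), ∃ ξ < ω_ 1, w < iterSup H' ξ := by
    intro w hw
    rw [iterSup.eq_1, Ordinal.lt_iSup_iff] at hw
    obtain ⟨a, ha⟩ := hw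
    exact ⟨a.1 + 1, add_one_lt_omega_one a.2, ha.trans_le (le_iterSup H' (lt_add_one _))⟩
  refine ⟨iterSup H' (ω_ 1), hq _ hω, ⟨iterSup H',
    fun ξ ζ h hζ => hstep _ _ h (hζ.trans hω), fun ξ hξ => hstep _ _ hξ hω, hsup⟩, ?_⟩
  intro t ht
  obtain ⟨ξ, hξ, h⟩ := hsup t ht
  exact (hle _ (hq _ (hξ.trans hω)) t h.le).trans (le_iterSup H' hξ)

/-! ### Hulls under set-valued operations on finite lists -/

/-- `x` is closed under `G`. -/
def ListClosed (G : List Ordinal.{u} → Set Ordinal.{u}) (x : Set Ordinal.{u}) : Prop :=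
  ∀ s : List Ordinal.{u}, (∀ a ∈ s, a ∈ x) → G s ⊆ x

/-- The least superset of `A` closed under `G`. -/
def hull (G : List Ordinal.{u} → Set Ordinal.{u}) (A : Set Ordinal.{u}) : Set Ordinal.{u} :=
  ⋂₀ {x | A ⊆ x ∧ ListClosed G x}

section Hulls

variable {G : List Ordinal.{u} → Set Ordinal.{u}} {A B x : Set Ordinal.{u}}

theorem subset_hull : A ⊆ hull G A := fun _ ha _ hx => hx.1 ha

theorem hull_subset (hA : A ⊆ x) (hx : ListClosed G x) : hull G A ⊆ x := fun _ ha => ha x ⟨hA, hx⟩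

theorem listClosed_hull : ListClosed G (hull G A) := fun s hs _ ha x hx =>
  hx.2 s (fun b hb => hs b hb x hx) ha

theorem hull_mono (h : A ⊆ B) : hull G A ⊆ hull G B :=
  hull_subset (h.trans subset_hull) listClosed_hull

theorem exists_forall_mem_of_directed {ι : Type*} [Nonempty ι] {X : ι → Set Ordinal.{u}}
    (hX : ∀ i j, ∃ k, X i ⊆ X k ∧ X j ⊆ X k) (s : List Ordinal.{u}) (hs : ∀ a ∈ s, ∃ i, a ∈ X i) :
    ∃ i, ∀ a ∈ s, a ∈ X i := by
  induction s with
  | nil => exact ⟨Classical.arbitrary ι, by simp⟩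
  | cons b s ih =>
    obtain ⟨i, hi⟩ := ih fun a ha => hs a (List.mem_cons_of_mem _ ha)
    obtain ⟨j, hj⟩ := hs b List.mem_cons_self
    obtain ⟨k, hik, hjk⟩ := hX i j
    refine ⟨k, fun a ha => ?_⟩
    rcases List.mem_cons.1 ha with rfl | ha
    · exact hjk hj
    · exact hik (hi a ha)

theorem listClosed_iUnion_of_directed {ι : Type*} [Nonempty ι] {X : ι → Set Ordinal.{u}}
    (hX : ∀ i j, ∃ k, X i ⊆ X k ∧ X j ⊆ X k) (h : ∀ i, ListClosed G (X i)) :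
    ListClosed G (⋃ i, X i) := by
  intro s hs
  obtain ⟨i, hi⟩ := exists_forall_mem_of_directed hX s fun a ha => mem_iUnion.1 (hs a ha)
  exact (h i s hi).trans (subset_iUnion X i)

theorem Set.Countable.setOf_list {s : Set Ordinal.{u}} (hs : s.Countable) :
    {l : List Ordinal.{u} | ∀ a ∈ l, a ∈ s}.Countable := by
  have := hs.to_subtype
  refine (countable_range fun l : List s => l.map Subtype.val).mono fun l hl => ?_
  exact ⟨l.attach.map fun a => ⟨a.1, hl a.1 a.2⟩, by simp [List.map_map, Function.comp_def]⟩

theorem countable_hull (hG : ∀ s, (G s).Countable) (hA : A.Countable) : (hull G A).Countable := by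
  let X : ℕ → Set Ordinal.{u} := fun n => Nat.rec A
    (fun _ y => y ∪ ⋃ s ∈ {l : List Ordinal.{u} | ∀ a ∈ l, a ∈ y}, G s) n
  have hsucc : ∀ n, X (n + 1) = X n ∪ ⋃ s ∈ {l : List Ordinal.{u} | ∀ a ∈ l, a ∈ X n}, G s :=
    fun n => rfl
  have hmono : Monotone X := monotone_nat_of_le_succ fun n => by
    rw [hsucc]
    exact subset_union_left
  have hc : ∀ n, (X n).Countable := by
    intro n
    induction n with
    | zero => exact hA
    | succ n ih =>
      rw [hsucc]
      exact ih.union (ih.setOf_list.biUnion fun s _ => hG s)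
  refine (countable_iUnion hc).mono (hull_subset (subset_iUnion X 0) ?_)
  intro s hs
  obtain ⟨n, hn⟩ := exists_forall_mem_of_directed
    (fun i j => ⟨max i j, hmono (le_max_left _ _), hmono (le_max_right _ _)⟩) s
    fun a ha => mem_iUnion.1 (hs a ha)
  refine Subset.trans ?_ (subset_iUnion X (n + 1))
  rw [hsucc]
  exact (subset_biUnion_of_mem (u := fun s => G s)
    (show s ∈ {l : List Ordinal.{u} | ∀ a ∈ l, a ∈ X n} from hn)).trans subset_union_right

/-- The operations have finite arity. This is what lets safety of all finite positions pass to the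
infinite play. -/
theorem hull_iUnion_subset {ι : Type*} [Nonempty ι] {X : ι → Set Ordinal.{u}}
    (hX : ∀ i j, ∃ k, X i ⊆ X k ∧ X j ⊆ X k) : hull G (⋃ i, X i) ⊆ ⋃ i, hull G (X i) :=
  hull_subset (iUnion_mono fun _ => subset_hull) <| listClosed_iUnion_of_directed
    (fun i j => (hX i j).imp fun _ h => ⟨hull_mono h.1, hull_mono h.2⟩) fun _ => listClosed_hull

/-! ### Clubs of countable sets -/

theorem isClubCountable_listClosed (hG : ∀ s, (G s).Countable)
    (hGA : ∀ s, (∀ a ∈ s, a ∈ A) → G s ⊆ A) :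
    IsClubCountable A {x ∈ countableSubsets A | ListClosed G x} where
  subset _ hx := hx.1
  cofinal x hx := ⟨hull G x, ⟨⟨hull_subset hx.1 hGA, countable_hull hG hx.2⟩, listClosed_hull⟩,
    subset_hull⟩
  closed η h₀ hη x hx hmono := by
    have : Nonempty (Iio η) := ⟨⟨0, h₀⟩⟩
    rw [biUnion_eq_iUnion]
    refine ⟨⟨iUnion_subset fun ξ => (hx ξ.1 ξ.2).1.1, ?_⟩, ?_⟩
    · have := (countable_Iio_of_lt hη).to_subtype
      exact countable_iUnion fun ξ => (hx ξ.1 ξ.2).1.2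
    · refine listClosed_iUnion_of_directed (fun i j => ?_) fun ξ => (hx ξ.1 ξ.2).2
      rcases le_total i j with h | h
      · exact ⟨j, hmono _ _ h j.2, subset_rfl⟩
      · exact ⟨i, subset_rfl, hmono _ _ h i.2⟩

theorem IsClubCountable.iUnion_mem {C : Set (Set Ordinal.{u})} (hC : IsClubCountable A C)
    {X : ℕ → Set Ordinal.{u}} (hX : Monotone X) (h : ∀ n, X n ∈ C) : ⋃ n, X n ∈ C := by
  have hcl := hC.closed ω omega0_pos omega0_lt_omega_one
    (fun ξ => ⋃ n ∈ {n : ℕ | (n : Ordinal.{u}) ≤ ξ}, X n) ?_ ?_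
  · convert hcl using 1
    apply Subset.antisymm
    · refine iUnion_subset fun n a ha => mem_biUnion (x := (n : Ordinal.{u}))
        (natCast_lt_omega0 n) (mem_biUnion (x := n) ?_ ha)
      exact le_refl (n : Ordinal.{u})
    · exact iUnion₂_subset fun _ _ => iUnion₂_subset fun n _ => subset_iUnion X n
  · intro ξ hξ
    obtain ⟨m, rfl⟩ := lt_omega0.1 hξ
    convert h m using 1
    apply Subset.antisymm
    · exact iUnion₂_subset fun n hn => hX (Nat.cast_le.1 (show (n : Ordinal.{u}) ≤ m from hn))
    · exact subset_biUnion_of_mem (u := X) (le_refl (m : Ordinal.{u}))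
  · exact fun ξ ζ h _ => biUnion_subset_biUnion_left fun n hn => le_trans hn h

open Classical in
/-- Iterating `H`, which sends countable subsets of `A` to larger ones, along a finite list. -/
noncomputable def listIter (A : Set Ordinal.{u}) (H : Set Ordinal.{u} → Set Ordinal.{u}) :
    List Ordinal.{u} → Set Ordinal.{u}
  | [] => H ∅
  | a :: s => if insert a (listIter A H s) ∈ countableSubsets A then
      H (insert a (listIter A H s)) else ∅

/-- Take `G` to be `listIter`. If x is enumerated by e, the values of `G` on the first n terms,
newest first, form an increasing chain in C whose union is x when x is closed. Nonemptiness provides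
the enumeration. -/
theorem IsClubCountable.exists_listClosed_mem {C : Set (Set Ordinal.{u})}
    (hC : IsClubCountable A C) : ∃ G : List Ordinal.{u} → Set Ordinal.{u},
      (∀ s, (G s).Countable) ∧ (∀ s, (∀ a ∈ s, a ∈ A) → G s ⊆ A) ∧
      ∀ x ⊆ A, x.Countable → x.Nonempty → ListClosed G x → x ∈ C := by
  choose! H hHC hH using hC.cofinal
  have h₀ : ∅ ∈ countableSubsets A := ⟨empty_subset _, countable_empty⟩
  have hmem : ∀ s, (∀ a ∈ s, a ∈ A) → listIter A H s ∈ C := by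
    intro s
    induction s with
    | nil => exact fun _ => hHC _ h₀
    | cons a s ih =>
      intro hs
      have h := hC.subset (ih fun b hb => hs b (List.mem_cons_of_mem _ hb))
      have h' : insert a (listIter A H s) ∈ countableSubsets A :=
        ⟨insert_subset (hs a List.mem_cons_self) h.1, h.2.insert a⟩
      rw [listIter, if_pos h']
      exact hHC _ h'
  have hcons : ∀ a s, (∀ b ∈ a :: s, b ∈ A) →
      insert a (listIter A H s) ⊆ listIter A H (a :: s) := by
    intro a s hs
    have h := hC.subset (hmem s fun b hb => hs b (List.mem_cons_of_mem _ hb))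
    have h' : insert a (listIter A H s) ∈ countableSubsets A :=
      ⟨insert_subset (hs a List.mem_cons_self) h.1, h.2.insert a⟩
    rw [listIter, if_pos h']
    exact hH _ h'
  refine ⟨listIter A H, fun s => ?_, fun s hs => (hC.subset (hmem s hs)).1, ?_⟩
  · cases s with
    | nil => exact (hC.subset (hHC _ h₀)).2
    | cons a s =>
      rw [listIter]
      split_ifs with h
      · exact (hC.subset (hHC _ h)).2
      · exact countable_empty
  · intro x hxA hx hne hcl
    obtain ⟨e, rfl⟩ := hx.exists_eq_range hne
    let L : ℕ → List Ordinal.{u} := fun n => ((List.range n).map e).reverse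
    have hL : ∀ n, L (n + 1) = e n :: L n := fun n => by simp [L, List.range_succ]
    have hLe : ∀ n, ∀ a ∈ L n, a ∈ range e := by
      intro n a ha
      simp only [L, List.mem_reverse, List.mem_map] at ha
      obtain ⟨k, -, rfl⟩ := ha
      exact mem_range_self k
    have hLA : ∀ n, ∀ a ∈ L n, a ∈ A := fun n a ha => hxA (hLe n a ha)
    have hins : ∀ n, insert (e n) (listIter A H (L n)) ⊆ listIter A H (L (n + 1)) := by
      intro n
      have := hcons (e n) (L n) (by rw [← hL]; exact hLA (n + 1))
      rwa [hL]
    have : range e = ⋃ n, listIter A H (L n) := by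
      apply Subset.antisymm
      · rintro _ ⟨n, rfl⟩
        exact mem_iUnion.2 ⟨n + 1, hins n (mem_insert _ _)⟩
      · exact iUnion_subset fun n => hcl _ (hLe n)
    rw [this]
    exact hC.iUnion_mem (monotone_nat_of_le_succ fun n => (subset_insert _ _).trans (hins n))
      fun n => hmem _ (hLA n)

end Hulls

/-! ### Uniform witnesses for a better scale -/

section UniformWitness

variable {f : Ordinal.{u} → ℕ → Ordinal.{u}} {κ α : Ordinal.{u}}

/-- `σ` witnesses uniformly that `f` is eventually increasing on `s`. -/
def IsUniformWitness (f : Ordinal.{u} → ℕ → Ordinal.{u}) (s : Set Ordinal.{u})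
    (σ : Ordinal.{u} → ℕ) : Prop :=
  ∀ a ∈ s, ∀ b ∈ s, a < b → LtFrom (max (σ a) (σ b)) (f a) (f b)

/-- The set s cuts α into intervals. Within one interval use the witness below its right endpoint;
across intervals compare a with the next point of s, then along s, then the last point of s with b.
-/
theorem exists_isUniformWitness_of_cofinal
    (hf : ∀ a b, a < b → b < κ → EventuallyLt (f a) (f b)) (hα : α < κ)
    (ih : ∀ γ < α, ∃ σ, IsUniformWitness f (Iio γ) σ) {s : Set Ordinal.{u}} (hs : s ⊆ Iio α)
    (hcof : ∀ b < α, ∃ c ∈ s, b < c)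
    (hmax : ∀ b < α, (∃ c ∈ s, c ≤ b) → ∃ c ∈ s, c ≤ b ∧ ∀ d ∈ s, d ≤ b → d ≤ c)
    {τ : Ordinal.{u} → ℕ} (hτ : IsUniformWitness f s τ) :
    ∃ σ, IsUniformWitness f (Iio α) σ := by
  choose! wit hwit using hf
  choose! ς hς using ih
  choose! pr hpr hprle hprmax using hmax
  have hnx : ∀ b < α, ∃ c ∈ s, b < c ∧ ∀ d ∈ s, b < d → c ≤ d := by
    intro b hb
    obtain ⟨c, hc, hbc⟩ := hcof b hb
    have h := csInf_mem (s := {c ∈ s | b < c}) ⟨c, hc, hbc⟩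
    exact ⟨_, h.1, h.2, fun d hd hbd => csInf_le' ⟨hd, hbd⟩⟩
  choose! nx hnxs hlt hnxle using hnx
  -- When no point of s is at most b, `pr b` is arbitrary and only enlarges the threshold.
  refine ⟨fun b => max (max (max (ς (nx b) b) (τ (nx b))) (wit b (nx b)))
    (max (τ (pr b)) (wit (pr b) b)), ?_⟩
  intro a ha b hb hab n hn
  simp only [max_le_iff] at hn
  obtain ⟨⟨⟨⟨ha1, ha2⟩, ha3⟩, ha4, ha5⟩, ⟨⟨hb1, hb2⟩, hb3⟩, hb4, hb5⟩ := hn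
  rcases lt_or_ge b (nx a) with h | h
  · have heq : nx a = nx b := le_antisymm (hnxle a ha _ (hnxs b hb) (hab.trans (hlt b hb)))
      (hnxle b hb _ (hnxs a ha) h)
    refine hς (nx a) (hs (hnxs a ha)) a (hlt a ha) b h hab n (max_le ha1 ?_)
    rw [heq]
    exact hb1
  · have hex : ∃ c ∈ s, c ≤ b := ⟨nx a, hnxs a ha, h⟩
    have h₁ : f a n < f (nx a) n :=
      hwit a _ (hlt a ha) ((hs (hnxs a ha)).trans hα) n ha3
    have h₂ : f (nx a) n ≤ f (pr b) n := by
      rcases (hprmax b hb hex _ (hnxs a ha) h).eq_or_lt with heq | hlt'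
      · rw [heq]
      · exact (hτ _ (hnxs a ha) _ (hpr b hb hex) hlt' n (max_le ha2 hb4)).le
    have h₃ : f (pr b) n ≤ f b n := by
      rcases (hprle b hb hex).eq_or_lt with heq | hlt'
      · rw [heq]
      · exact (hwit _ b hlt' (lt_trans hb hα) n hb5).le
    exact h₁.trans_le (h₂.trans h₃)

theorem exists_isUniformWitness_range (hf : ∀ a b, a < b → b < κ → EventuallyLt (f a) (f b))
    {g : ℕ → Ordinal.{u}} (hg : StrictMono g) (hgκ : ∀ n, g n < κ) :
    ∃ σ, IsUniformWitness f (range g) σ := by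
  classical
  choose! wit hwit using hf
  -- The k-th term has only finitely many predecessors, so one threshold handles them all.
  refine ⟨fun c => if h : ∃ k, g k = c then
    (Finset.range h.choose).sup fun j => wit (g j) c else 0, ?_⟩
  rintro _ ⟨j, rfl⟩ _ ⟨k, rfl⟩ hjk n hn
  have hjk' := hg.lt_iff_lt.1 hjk
  have hex : ∃ i, g i = g k := ⟨k, rfl⟩
  have hch : hex.choose = k := hg.injective hex.choose_spec
  refine hwit _ _ hjk (hgκ k) n (le_trans ?_ ((le_max_right _ _).trans hn))
  simp only [dif_pos hex, hch]
  exact Finset.le_sup (f := fun j => wit (g j) (g k)) (Finset.mem_range.2 hjk')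

/-- Induction on α: betterness is needed only at uncountable cofinality, as a cofinal ω-sequence has
a uniform witness for any eventually increasing f. -/
theorem exists_isUniformWitness (hf : ∀ a b, a < b → b < κ → EventuallyLt (f a) (f b))
    (hbetter : ∀ α < κ, ℵ₀ < α.cof → ∃ (C : Set (Set.Iio α)) (σ : C → ℕ), IsClub C ∧
      ∀ β γ : C, β < γ → LtFrom (max (σ β) (σ γ)) (f β.1.1) (f γ.1.1)) (hα : α < κ) :
    ∃ σ, IsUniformWitness f (Iio α) σ := by
  classical
  induction α using Ordinal.limitRecOn with
  | zero => exact ⟨fun _ => 0, fun a ha => absurd ha (by simp)⟩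
  | add_one γ ih =>
    obtain ⟨σ, hσ⟩ := ih ((lt_add_one γ).trans hα)
    choose! wit hwit using hf
    refine ⟨fun a => max (σ a) (wit a γ), fun a ha b hb hab n hn => ?_⟩
    simp only [max_le_iff] at hn
    rcases (Order.lt_add_one_iff.1 (mem_Iio.1 hb)).eq_or_lt with rfl | h
    · exact hwit a b hab ((lt_add_one _).trans hα) n hn.1.2
    · exact hσ a (hab.trans h) b h hab n (max_le hn.1.1 hn.2.1)
  | limit α hlim ih =>
    have ih' : ∀ γ < α, ∃ σ, IsUniformWitness f (Iio γ) σ := fun γ h => ih γ h (h.trans hα)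
    rcases (aleph0_le_cof_iff.2 (one_lt_cof_iff.2 hlim)).eq_or_lt with hcof | hcof
    · obtain ⟨h, hh⟩ := exists_isFundamentalSeq (o := α) (a := ω)
        (by rw [← hcof, Cardinal.ord_aleph0])
      let g : ℕ → Ordinal.{u} := fun n => (h ⟨n, natCast_lt_omega0 n⟩).1
      have hg : StrictMono g := fun m n hmn => hh.strictMono
        (show (m : Ordinal.{u}) < n from Nat.cast_lt.2 hmn)
      obtain ⟨τ, hτ⟩ := exists_isUniformWitness_range hf hg fun n =>
        lt_trans (h ⟨n, natCast_lt_omega0 n⟩).2 hα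
      have hgcof : ∀ b < α, ∃ n, b < g n := by
        intro b hb
        obtain ⟨_, ⟨⟨c, hc⟩, rfl⟩, hle⟩ := hh.isCofinal_range ⟨b + 1, hlim.add_one_lt hb⟩
        obtain ⟨n, rfl⟩ := lt_omega0.1 hc
        exact ⟨n, (lt_add_one b).trans_le hle⟩
      refine exists_isUniformWitness_of_cofinal hf hα ih' (s := range g) ?_ ?_ ?_ hτ
      · rintro _ ⟨n, rfl⟩
        exact (h ⟨n, natCast_lt_omega0 n⟩).2
      · intro b hb
        obtain ⟨n, hn⟩ := hgcof b hb
        exact ⟨g n, ⟨n, rfl⟩, hn⟩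
      · rintro b hb ⟨_, ⟨k, rfl⟩, hk⟩
        obtain ⟨n, hn⟩ := hgcof b hb
        have hlt : ∀ j, g j ≤ b → j ≤ n := fun j hj => (hg.lt_iff_lt.1 (hj.trans_lt hn)).le
        refine ⟨g (Nat.findGreatest (fun j => g j ≤ b) n), ⟨_, rfl⟩,
          Nat.findGreatest_spec (P := fun j => g j ≤ b) (hlt k hk) hk, ?_⟩
        rintro _ ⟨j, rfl⟩ hj
        exact hg.monotone (Nat.le_findGreatest (hlt j hj) hj)
    · obtain ⟨C, σ, hC, hσ⟩ := hbetter α hα hcof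
      refine exists_isUniformWitness_of_cofinal hf hα ih' (s := Subtype.val '' C)
        (τ := fun c => if h : ∃ hc : c ∈ Iio α, ⟨c, hc⟩ ∈ C then σ ⟨_, h.choose_spec⟩ else 0)
        ?_ ?_ ?_ ?_
      · rintro _ ⟨c, -, rfl⟩
        exact c.2
      · intro b hb
        obtain ⟨c, hc, hle⟩ := hC.isCofinal ⟨b + 1, hlim.add_one_lt hb⟩
        exact ⟨c.1, ⟨c, hc, rfl⟩, (lt_add_one b).trans_le hle⟩
      · rintro b hb ⟨_, ⟨c, hc, rfl⟩, hcb⟩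
        let t : Set (Iio α) := {d ∈ C | d.1 ≤ b}
        have hbdd : BddAbove (Subtype.val '' t) := ⟨b, by rintro _ ⟨d, hd, rfl⟩; exact hd.2⟩
        have hne : (Subtype.val '' t).Nonempty := ⟨c.1, c, ⟨hc, hcb⟩, rfl⟩
        have hle : sSup (Subtype.val '' t) ≤ b := csSup_le hne (by rintro _ ⟨d, hd, rfl⟩; exact hd.2)
        -- Closedness of C makes this supremum the last point of C that is at most b.
        have hlub : IsLUB t ⟨sSup (Subtype.val '' t), hle.trans_lt hb⟩ :=
          ⟨fun d hd => le_csSup hbdd ⟨d, hd, rfl⟩, fun e he => csSup_le hne (by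
            rintro _ ⟨d, hd, rfl⟩
            exact he hd)⟩
        have hmem := hC.isLUB_mem (fun d (hd : d ∈ t) => hd.1) ⟨c, hc, hcb⟩ hlub
        refine ⟨_, ⟨_, hmem, rfl⟩, hle, ?_⟩
        rintro _ ⟨d, hd, rfl⟩ hdb
        exact hlub.1 ⟨hd, hdb⟩
      · rintro _ ⟨c, hc, rfl⟩ _ ⟨d, hd, rfl⟩ hcd
        have h₁ : ∃ h : c.1 ∈ Iio α, ⟨c.1, h⟩ ∈ C := ⟨c.2, hc⟩
        have h₂ : ∃ h : d.1 ∈ Iio α, ⟨d.1, h⟩ ∈ C := ⟨d.2, hd⟩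
        simp only [dif_pos h₁, dif_pos h₂]
        exact hσ ⟨c, hc⟩ ⟨d, hd⟩ hcd

end UniformWitness

/-! ### The non-reflecting set -/

section NonReflecting

/-- The countably infinite `x ⊆ κ` with `x ∩ ω₁ = δ` for some `δ`, for which there are `γ, β < κ`
such that, for almost all even `n`, `x` meets the interval `(f γ n, f β n]` and, for almost all odd
`n`, `x` has a member of cofinality `ω₁` above `f β n` whose ladder takes values at most `f γ n`
on `δ`. -/
def ladderSets (i : Ordinal.{u} → Ordinal.{u} → Ordinal.{u}) (f : Ordinal.{u} → ℕ → Ordinal.{u})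
    (κ : Ordinal.{u}) : Set (Set Ordinal.{u}) :=
  {x | x ∈ omegaSubsets (Iio κ) ∧ ∃ δ < ω_ 1, x ∩ Iio (ω_ 1) = Iio δ ∧
    ∃ γ < κ, ∃ β < κ, ∃ m : ℕ, ∀ n ≥ m,
      (Even n → ∃ v ∈ x, f γ n < v ∧ v ≤ f β n) ∧
      (Odd n → ∃ v ∈ x, IsOmegaOneCofinal (i v) v ∧ f β n < v ∧ ∀ ξ < δ, i v ξ ≤ f γ n)}

variable {i : Ordinal.{u} → Ordinal.{u} → Ordinal.{u}} {f : Ordinal.{u} → ℕ → Ordinal.{u}}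

theorem isFull_ladderSets {κ : Ordinal.{u}} : IsFull (Iio κ) (ladderSets i f κ) := by
  refine ⟨fun x hx => hx.1, ?_⟩
  rintro x ⟨-, δ, hδ, hxδ, γ, hγ, β, hβ, m, h⟩ y hy ⟨hxy, hω⟩
  refine ⟨hy, δ, hδ, hω ▸ hxδ, γ, hγ, β, hβ, m, fun n hn => ⟨fun he => ?_, fun ho => ?_⟩⟩
  · obtain ⟨v, hv, h'⟩ := (h n hn).1 he
    exact ⟨v, hxy hv, h'⟩
  · obtain ⟨v, hv, h'⟩ := (h n hn).2 ho
    exact ⟨v, hxy hv, h'⟩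

theorem exists_enumeration_omega_one {I : Set Ordinal.{u}} (hI : #I = ℵ₁) :
    ∃ e e' : Ordinal.{u} → Ordinal.{u}, (∀ ξ < ω_ 1, e ξ ∈ I) ∧
      ∀ v ∈ I, e' v < ω_ 1 ∧ e (e' v) = v := by
  classical
  have hcard : #(Iio (ω_ 1 : Ordinal.{u})) = #I := by
    rw [Cardinal.mk_Iio_ordinal, hI, ← Cardinal.ord_aleph, Cardinal.card_ord]
    simp
  obtain ⟨E⟩ := Cardinal.eq.1 hcard
  refine ⟨fun ξ => if h : ξ ∈ Iio (ω_ 1) then (E ⟨ξ, h⟩).1 else 0,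
    fun v => if h : v ∈ I then (E.symm ⟨v, h⟩).1 else 0, fun ξ hξ => ?_, fun v hv => ?_⟩
  · simp only [dif_pos (mem_Iio.2 hξ)]
    exact (E ⟨ξ, hξ⟩).2
  · have h := (E.symm ⟨v, hv⟩).2
    simp only [dif_pos hv]
    refine ⟨h, ?_⟩
    rw [dif_pos h]
    simp

theorem not_isStationaryCountable_ladderSets {c : Cardinal.{u}} (hc : c.IsRegular) (hc₁ : ℵ₁ < c)
    (hf : ∀ α < c.ord, ∃ σ, IsUniformWitness f (Iio α) σ) {I : Set Ordinal.{u}} (hI : #I = ℵ₁)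
    (hωI : Iio (ω_ 1) ⊆ I) :
    ¬ IsStationaryCountable I (ladderSets i f c.ord ∩ omegaSubsets I) := by
  classical
  rintro ⟨-, hstat⟩
  obtain ⟨e, e', heI, he'⟩ := exists_enumeration_omega_one hI
  have hS : ∀ x ∈ ladderSets i f c.ord, ∃ δ γ β, ∃ m : ℕ, x ∩ Iio (ω_ 1) = Iio δ ∧ γ < c.ord ∧
      β < c.ord ∧ ∀ n ≥ m, (Even n → ∃ v ∈ x, f γ n < v ∧ v ≤ f β n) ∧
      (Odd n → ∃ v ∈ x, IsOmegaOneCofinal (i v) v ∧ f β n < v ∧ ∀ ξ < δ, i v ξ ≤ f γ n) := by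
    rintro x ⟨-, δ, -, hxδ, γ, hγ, β, hβ, m, h⟩
    exact ⟨δ, γ, β, m, hxδ, hγ, hβ, h⟩
  choose! δ γ β m hδ hγ hβ hx using hS
  have hω : ω_ 1 < c.ord := by
    rw [← Cardinal.ord_aleph]
    exact Cardinal.ord_lt_ord.2 hc₁
  obtain ⟨α, hα, hle⟩ := exists_bound hc hω
    (F := fun ξ => if e '' Iio ξ ∈ ladderSets i f c.ord then
      max (γ (e '' Iio ξ)) (β (e '' Iio ξ)) else 0) (fun ξ _ => by
        split_ifs with h
        · exact max_lt (hγ _ h) (hβ _ h)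
        · exact hc.ord_pos)
  have hle' : ∀ ξ < ω_ 1, e '' Iio ξ ∈ ladderSets i f c.ord →
      γ (e '' Iio ξ) < α + 1 ∧ β (e '' Iio ξ) < α + 1 := by
    intro ξ hξ h
    have := hle ξ hξ
    rw [if_pos h, max_le_iff] at this
    exact ⟨Order.lt_add_one_iff.2 this.1, Order.lt_add_one_iff.2 this.2⟩
  obtain ⟨σ, hσ⟩ := hf (α + 1) (add_one_lt_ord hc hα)
  -- ξ bounds, via the ladder of v', coordinate k of every f γ whose coordinate n is below v, over
  -- all γ with threshold at most n and k. It does not mention x, so x can be closed under a choice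
  -- of ξ.
  let P : Ordinal.{u} → Ordinal.{u} → ℕ → ℕ → Ordinal.{u} → Prop := fun v v' n k ξ =>
    ξ < ω_ 1 ∧ ∀ ζ < ω_ 1, e '' Iio ζ ∈ ladderSets i f c.ord →
      σ (γ (e '' Iio ζ)) ≤ n → σ (γ (e '' Iio ζ)) ≤ k → f (γ (e '' Iio ζ)) n < v →
      f (γ (e '' Iio ζ)) k < i v' ξ
  have hX : ∀ v v' n k, ∃ ξ, (∃ ξ', P v v' n k ξ') → P v v' n k ξ := by
    intro v v' n k
    by_cases h : ∃ ξ', P v v' n k ξ'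
    · exact ⟨h.choose, fun _ => h.choose_spec⟩
    · exact ⟨0, fun h' => absurd h' h⟩
  choose X hX using hX
  -- Closure under `e` and `e'` forces x to be the image of x ∩ ω₁ under `e`; intersecting with I
  -- discards junk values.
  let G : List Ordinal.{u} → Set Ordinal.{u} := fun s => match s with
    | [v, v'] => insert (e v) (insert (e' v) (range fun p : ℕ × ℕ => X v v' p.1 p.2)) ∩ I
    | _ => ∅
  have hGc : ∀ s, (G s).Countable := by
    intro s
    simp only [G]
    split
    · exact (((countable_range _).insert _).insert _).mono inter_subset_left
    · exact countable_empty
  have hGI : ∀ s, (∀ a ∈ s, a ∈ I) → G s ⊆ I := by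
    intro s _
    simp only [G]
    split
    · exact inter_subset_right
    · exact empty_subset _
  obtain ⟨x, ⟨hxS, hxI, -⟩, -, hcl⟩ := hstat _ (isClubCountable_listClosed hGc hGI)
  have hcl₂ : ∀ v ∈ x, ∀ v' ∈ x, G [v, v'] ⊆ x := fun v hv v' hv' => hcl [v, v'] (by simp [hv, hv'])
  have hxδ := hδ x hxS
  have hmemδ : ∀ a, a < δ x ↔ a ∈ x ∧ a < ω_ 1 := fun a => (Set.ext_iff.1 hxδ a).symm
  have hδω : δ x < ω_ 1 := by
    by_contra! h
    obtain ⟨-, hcount, -⟩ := hxS.1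
    have hsub : Iio (ω_ 1) ⊆ x := fun a ha => ((hmemδ a).1 (lt_of_lt_of_le ha h)).1
    have := exists_bound_lt_omega_one (hcount.mono hsub) fun a ha => ha
    obtain ⟨B, hB, hBle⟩ := this
    exact (hBle _ (add_one_lt_omega_one hB)).not_gt (lt_add_one B)
  have hxe : e '' Iio (δ x) = x := by
    apply Subset.antisymm
    · rintro _ ⟨ξ, hξ, rfl⟩
      have h := (hmemδ ξ).1 hξ
      exact hcl₂ ξ h.1 ξ h.1 ⟨mem_insert _ _, heI ξ h.2⟩
    · intro v hv
      have h := he' v (hxI hv)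
      refine ⟨e' v, (hmemδ _).2 ⟨hcl₂ v hv v hv ⟨mem_insert_of_mem _ (mem_insert _ _), ?_⟩, h.1⟩, h.2⟩
      exact hωI h.1
  have hmem : e '' Iio (δ x) ∈ ladderSets i f c.ord := hxe.symm ▸ hxS
  have hbd := hle' _ hδω hmem
  rw [hxe] at hbd
  let M := max (m x) (max (σ (γ x)) (σ (β x)))
  have hmM : m x ≤ M := le_max_left _ _
  have hγM : σ (γ x) ≤ M := (le_max_left _ _).trans (le_max_right _ _)
  have hβM : σ (β x) ≤ M := (le_max_right _ _).trans (le_max_right _ _)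
  have hn : M ≤ 2 * M := by omega
  have hk : M ≤ 2 * M + 1 := by omega
  generalize hn' : 2 * M = n at hn hk
  obtain ⟨v, hv, hγv, hvβ⟩ := (hx x hxS n (hmM.trans hn)).1 (hn' ▸ even_two_mul M)
  obtain ⟨v', hv', hcof, hβv', hγv'⟩ := (hx x hxS (n + 1) (hmM.trans hk)).2
    (hn' ▸ odd_two_mul_add_one M)
  by_cases hex : ∃ ξ, P v v' n (n + 1) ξ
  · obtain ⟨hlt, hP⟩ := hX v v' n (n + 1) hex
    have hXx : X v v' n (n + 1) ∈ x := hcl₂ v hv v' hv'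
      ⟨mem_insert_of_mem _ (mem_insert_of_mem _ ⟨(n, n + 1), rfl⟩), hωI hlt⟩
    have h₁ := hγv' _ ((hmemδ _).2 ⟨hXx, hlt⟩)
    have h₂ := hP (δ x) hδω hmem
    rw [hxe] at h₂
    exact (h₂ (hγM.trans hn) (hγM.trans hk) hγv).not_ge h₁
  -- Choose ξ with the ladder above f β at the odd coordinate. Its failure gives a with f a below f
  -- β at n but above it at n + 1, which σ excludes.
  · obtain ⟨ξ, hξ, hβξ⟩ := hcof.2.2 _ hβv'
    have hnot := mt (fun h => (⟨ξ, h⟩ : ∃ ξ, P v v' n (n + 1) ξ)) hex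
    simp only [P, not_and, not_forall, not_lt] at hnot
    obtain ⟨ζ, hζ, hζS, han, hak, hav, hle⟩ := hnot hξ
    have ha := (hle' ζ hζ hζS).1
    generalize γ (e '' Iio ζ) = a at *
    have hlt := hβξ.trans_le hle
    rcases lt_trichotomy a (β x) with h | h | h
    · exact (hσ a ha (β x) hbd.2 h (n + 1) (max_le hak (hβM.trans hk))).not_gt hlt
    · exact absurd hlt (by rw [h]; exact lt_irrefl _)
    · exact ((hσ (β x) hbd.2 a ha h n (max_le (hβM.trans hn) han)).trans hav).not_ge hvβ

end NonReflecting

/-! ### Stationarity of the non-reflecting set -/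

section Stationary

variable {i : Ordinal.{u} → Ordinal.{u} → Ordinal.{u}} {l : ℕ → Cardinal.{u}}
  {G : List Ordinal.{u} → Set Ordinal.{u}} {δ : Ordinal.{u}}

/-- The hull of `δ` and the members of `s` has no new countable ordinals. -/
def IsSafe (G : List Ordinal.{u} → Set Ordinal.{u}) (δ : Ordinal.{u}) (s : List Ordinal.{u}) :
    Prop :=
  hull G (Iio δ ∪ {a | a ∈ s}) ∩ Iio (ω_ 1) ⊆ Iio δ

/-- Positions, listed with the latest move first, that are lost for the player who, at move `n`,
names `t < l n`, is answered by `α < l n`, and then has to choose `v ∈ [α, l n)` of cofinality `ω₁`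
whose ladder is bounded by `t` on `δ`, so that all finite positions stay safe. -/
inductive IsLosing (i : Ordinal.{u} → Ordinal.{u} → Ordinal.{u}) (l : ℕ → Cardinal.{u})
    (G : List Ordinal.{u} → Set Ordinal.{u}) (δ : Ordinal.{u}) : List Ordinal.{u} → Prop
  | of_not_isSafe (s : List Ordinal.{u}) : ¬ IsSafe G δ s → IsLosing i l G δ s
  | of_forall (s : List Ordinal.{u}) (α : Ordinal.{u} → Ordinal.{u})
      (hα : ∀ t < (l s.length).ord, α t < (l s.length).ord)
      (h : ∀ t < (l s.length).ord, ∀ v, α t ≤ v → v < (l s.length).ord →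
        IsOmegaOneCofinal (i v) v → (∀ ξ < δ, i v ξ ≤ t) → IsLosing i l G δ (v :: s)) :
      IsLosing i l G δ s

/-- The list of the first `n` values of `v`, the last one first. -/
def revPrefix (v : ℕ → Ordinal.{u}) (n : ℕ) : List Ordinal.{u} :=
  ((List.range n).map v).reverse

theorem revPrefix_succ (v : ℕ → Ordinal.{u}) (n : ℕ) :
    revPrefix v (n + 1) = v n :: revPrefix v n := by
  simp [revPrefix, List.range_succ]

/-- Induction on the losing tree. A choice at an earlier move ranges over fewer than l k ordinals,
so by regularity the opponent's replies at move k are bounded independently of the position. -/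
theorem IsLosing.exists_bounds (hmono : StrictMono l) (hreg : ∀ n, (l n).IsRegular)
    {s : List Ordinal.{u}} (hs : IsLosing i l G δ s) :
    ∃ h : ℕ → Ordinal.{u} → Ordinal.{u}, (∀ n, ∀ t < (l n).ord, h n t < (l n).ord) ∧
      ∀ v : ℕ → Ordinal.{u}, revPrefix v s.length = s →
        (∀ k ≥ s.length, v k < (l k).ord ∧ IsOmegaOneCofinal (i (v k)) (v k) ∧
          ∃ t < (l k).ord, (∀ ξ < δ, i (v k) ξ ≤ t) ∧ h k t ≤ v k) →
        ∃ n, ¬ IsSafe G δ (revPrefix v n) := by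
  classical
  induction hs with
  | of_not_isSafe s hs =>
    exact ⟨fun _ _ => 0, fun n _ _ => (hreg n).ord_pos, fun v hv _ =>
      ⟨s.length, by rwa [hv]⟩⟩
  | of_forall s α hα _ ih =>
    let Q : Ordinal.{u} → Prop := fun v => v < (l s.length).ord ∧ IsOmegaOneCofinal (i v) v ∧
      ∃ t < (l s.length).ord, α t ≤ v ∧ ∀ ξ < δ, i v ξ ≤ t
    have ih' : ∀ v, Q v → _ := fun v ⟨hv, hcof, t, ht, hαt, hb⟩ => ih t ht v hαt hv hcof hb
    choose! h hh hspec using ih'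
    have hB : ∀ k, ∀ t < (l k).ord, ∃ B < (l k).ord, (k = s.length → α t ≤ B) ∧
        (s.length < k → ∀ v, Q v → h v k t ≤ B) := by
      intro k t ht
      rcases lt_trichotomy k s.length with hk | rfl | hk
      · exact ⟨0, (hreg k).ord_pos, fun h => absurd h hk.ne, fun h => absurd h hk.not_gt⟩
      · exact ⟨α t, hα t ht, fun _ => le_rfl, fun h => absurd h (lt_irrefl _)⟩
      · obtain ⟨B, hB, hle⟩ := exists_bound (hreg k) (Cardinal.ord_lt_ord.2 (hmono hk))
          (F := fun v => if Q v then h v k t else 0) (fun v _ => by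
            split_ifs with hQ
            · exact hh v hQ k t ht
            · exact (hreg k).ord_pos)
        refine ⟨B, hB, fun h => absurd h hk.ne', fun _ v hQ => ?_⟩
        have := hle v hQ.1
        rwa [if_pos hQ] at this
    choose! H hH hHα hHh using hB
    refine ⟨H, hH, fun v hv hcond => ?_⟩
    obtain ⟨hlt, hcof, t, ht, hb, hle⟩ := hcond s.length le_rfl
    have hQ : Q (v s.length) := ⟨hlt, hcof, t, ht, (hHα _ t ht rfl).trans hle, hb⟩
    refine hspec _ hQ v (by rw [List.length_cons, revPrefix_succ, hv]) fun k hk => ?_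
    rw [List.length_cons] at hk
    obtain ⟨hlt', hcof', t', ht', hb', hle'⟩ := hcond k (Nat.le_of_succ_le hk)
    exact ⟨hlt', hcof', t', ht', hb', (hHh k t' ht' hk _ hQ).trans hle'⟩

theorem exists_eq_Iio_of_countable {D : Set Ordinal.{u}} (hD : D.Countable)
    (hω : D ⊆ Iio (ω_ 1)) (hdown : ∀ a ∈ D, ∀ b < a, b ∈ D) : ∃ δ < ω_ 1, D = Iio δ := by
  obtain ⟨B, hB, hle⟩ := exists_bound_lt_omega_one hD hω
  have hmem : B + 1 ∈ Dᶜ := fun h => (hle _ h).not_gt (lt_add_one B)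
  have hinf := csInf_mem (s := Dᶜ) ⟨_, hmem⟩
  refine ⟨sInf Dᶜ, (csInf_le' hmem).trans_lt (add_one_lt_omega_one hB), ?_⟩
  ext a
  refine ⟨fun ha => ?_, fun ha => ?_⟩
  · by_contra h
    rcases (not_lt.1 (mt mem_Iio.2 h)).eq_or_lt with heq | hlt
    · exact hinf (heq ▸ ha)
    · exact hinf (hdown a ha _ hlt)
  · by_contra h
    exact (csInf_le' (s := Dᶜ) h).not_gt ha

/-- If every δ lost, the bounds could be merged over all δ < ω₁. Choosing v k closed under the
merged bounds before δ, and then δ as the trace on ω₁ of a hull containing every v k, gives a play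
that beats them yet stays safe. -/
theorem exists_not_isLosing_nil (hi : ∀ v, (∃ g, IsOmegaOneCofinal g v) → IsOmegaOneCofinal (i v) v)
    (hmono : StrictMono l) (hreg : ∀ n, (l n).IsRegular) (hl : ∀ n, ℵ₁ < l n)
    (hG : ∀ s, (G s).Countable) : ∃ δ, ω ≤ δ ∧ δ < ω_ 1 ∧ ¬ IsLosing i l G δ [] := by
  classical
  by_contra! hlose
  have hb : ∀ δ, ω ≤ δ → δ < ω_ 1 → _ := fun δ h₁ h₂ => (hlose δ h₁ h₂).exists_bounds hmono hreg
  choose! h hh hspec using hb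
  have hω : ∀ k, ω_ 1 < (l k).ord := fun k => by
    rw [← Cardinal.ord_aleph]
    exact Cardinal.ord_lt_ord.2 (hl k)
  have hB : ∀ k, ∀ t < (l k).ord, ∃ B < (l k).ord, ∀ δ, ω ≤ δ → δ < ω_ 1 → h δ k t ≤ B := by
    intro k t ht
    obtain ⟨B, hB, hle⟩ := exists_bound (hreg k) (hω k)
      (F := fun δ => if ω ≤ δ then h δ k t else 0) (fun δ hδ => by
        split_ifs with hωδ
        · exact hh δ hωδ hδ k t ht
        · exact (hreg k).ord_pos)
    refine ⟨B, hB, fun δ hωδ hδ => ?_⟩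
    have := hle δ hδ
    rwa [if_pos hωδ] at this
  choose! H hH hle using hB
  choose v hv hcof hcl using fun k => exists_isOmegaOneCofinal_closed (hreg k) (hl k) (hH k)
  -- Adding initial segments of countable ordinals makes the trace of the hull on ω₁ an ordinal.
  let G' : List Ordinal.{u} → Set Ordinal.{u} := fun s =>
    G s ∪ ⋃ a ∈ {a | a ∈ s ∧ a < ω_ 1}, Iio a
  have hG' : ∀ s, (G' s).Countable := fun s => (hG s).union <|
    ((s.finite_toSet.subset fun a ha => ha.1).countable).biUnion fun a ha => countable_Iio_of_lt ha.2
  let M := hull G' (Iio ω ∪ range v)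
  have hM : M.Countable := countable_hull hG' <|
    (countable_Iio_of_lt omega0_lt_omega_one).union (countable_range v)
  obtain ⟨δ, hδ, hMδ⟩ := exists_eq_Iio_of_countable (D := M ∩ Iio (ω_ 1))
    (hM.mono inter_subset_left) inter_subset_right (by
      rintro a ⟨haM, haω⟩ b hba
      refine ⟨listClosed_hull [a] (by simpa using haM) (Or.inr ?_), hba.trans haω⟩
      exact mem_biUnion (x := a) ⟨List.mem_singleton.2 rfl, haω⟩ hba)
  have hMG : ListClosed G M := fun s hs => subset_union_left.trans (listClosed_hull s hs)
  have hδM : Iio δ ⊆ M := hMδ ▸ inter_subset_left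
  have hωδ : ω ≤ δ := by
    by_contra! hlt
    have : δ ∈ M ∩ Iio (ω_ 1) := ⟨subset_hull (Or.inl hlt), hδ⟩
    rw [hMδ] at this
    exact lt_irrefl δ (mem_Iio.1 this)
  obtain ⟨n, hn⟩ := hspec δ hωδ hδ v rfl fun k _ => by
    obtain ⟨t, ht, hbt⟩ := (hi _ (hcof k)).exists_bound hδ
    exact ⟨hv k, hi _ (hcof k), t, ht.trans (hv k), hbt,
      (hle k t (ht.trans (hv k)) δ hωδ hδ).trans (hcl k t ht)⟩
  refine hn ?_
  refine (inter_subset_inter_left _ ?_).trans hMδ.subset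
  refine (hull_subset (union_subset hδM ?_) hMG)
  intro a ha
  simp only [revPrefix, List.mem_reverse, List.mem_map, mem_ofPred_eq] at ha
  obtain ⟨k, -, rfl⟩ := ha
  exact subset_hull (Or.inr (mem_range_self k))

/-- The entry of `s` made at move `n` is below `l n`. -/
def IsAdmissible (l : ℕ → Cardinal.{u}) : List Ordinal.{u} → Prop
  | [] => True
  | v :: s => v < (l s.length).ord ∧ IsAdmissible l s

/-- There are fewer than c admissible positions of length n; the supremum is taken one entry at a
time. -/
theorem exists_bound_of_isAdmissible {n : ℕ} {c : Cardinal.{u}} (hc : c.IsRegular)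
    (hlc : ∀ j < n, l j < c) {F : List Ordinal.{u} → Ordinal.{u}}
    (hF : ∀ s, s.length = n → IsAdmissible l s → F s < c.ord) :
    ∃ B < c.ord, ∀ s, s.length = n → IsAdmissible l s → F s ≤ B := by
  induction n generalizing F with
  | zero =>
    refine ⟨F [], hF [] rfl trivial, fun s hs _ => ?_⟩
    rw [List.length_eq_zero_iff.1 hs]
  | succ n ih =>
    have hB : ∀ v < (l n).ord, ∃ B < c.ord, ∀ s, s.length = n → IsAdmissible l s →
        F (v :: s) ≤ B := fun v hv =>
      ih (fun j hj => hlc j (hj.trans n.lt_succ_self)) fun s hs hadm =>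
        hF (v :: s) (by simp [hs]) ⟨hs.symm ▸ hv, hadm⟩
    choose! B hB hle using hB
    obtain ⟨B', hB', hle'⟩ := exists_bound hc (Cardinal.ord_lt_ord.2 (hlc n n.lt_succ_self)) hB
    refine ⟨B', hB', fun s hs hadm => ?_⟩
    cases s with
    | nil => simp at hs
    | cons v s =>
      have hs' : s.length = n := by simpa using hs
      have hv : v < (l n).ord := hs' ▸ hadm.1
      exact (hle v hv s hs' hadm.2).trans (hle' v hv)

theorem isSafe_of_not_isLosing {s : List Ordinal.{u}} (hs : ¬ IsLosing i l G δ s) :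
    IsSafe G δ s := by
  by_contra h
  exact hs (.of_not_isSafe s h)

theorem exists_move_of_not_isLosing {s : List Ordinal.{u}} (hs : ¬ IsLosing i l G δ s) :
    ∃ t < (l s.length).ord, ∀ α < (l s.length).ord, ∃ v, α ≤ v ∧ v < (l s.length).ord ∧
      IsOmegaOneCofinal (i v) v ∧ (∀ ξ < δ, i v ξ ≤ t) ∧ ¬ IsLosing i l G δ (v :: s) := by
  by_contra! h
  choose! α hα h using h
  exact hs (.of_forall s α hα h)

theorem isStationaryCountable_ladderSets {c : Cardinal.{u}} {f : Ordinal.{u} → ℕ → Ordinal.{u}}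
    (hi : ∀ v, (∃ g, IsOmegaOneCofinal g v) → IsOmegaOneCofinal (i v) v)
    (hmono : StrictMono l) (hreg : ∀ n, (l n).IsRegular) (hl : ∀ n, ℵ₁ < l n)
    (hlc : ∀ n, l n ≤ c) (hmem : ∀ β < c.ord, f β ∈ ordProd l)
    (hcof : ∀ g ∈ ordProd l, ∃ β < c.ord, EventuallyLt g (f β)) :
    IsStationaryCountable (Iio c.ord) (ladderSets i f c.ord) := by
  classical
  refine ⟨fun x hx => ⟨hx.1.1, hx.1.2.1⟩, fun C hC => ?_⟩
  obtain ⟨G, hG, hGA, hGC⟩ := hC.exists_listClosed_mem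
  obtain ⟨δ, hωδ, hδ, hwin⟩ := exists_not_isLosing_nil hi hmono hreg hl hG
  choose! τ hτ nxt hge hlt hcofn hbd hnl using
    fun (s : List Ordinal.{u}) (hs : ¬ IsLosing i l G δ s) => exists_move_of_not_isLosing hs
  have hbound : ∀ F : List Ordinal.{u} → Ordinal.{u},
      (∀ s, ¬ IsLosing i l G δ s → F s < (l s.length).ord) → ∃ B ∈ ordProd l,
        ∀ s, IsAdmissible l s → ¬ IsLosing i l G δ s → F s ≤ B s.length := by
    intro F hF
    have : ∀ n, ∃ B < (l n).ord, ∀ s, s.length = n → IsAdmissible l s →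
        (if IsLosing i l G δ s then 0 else F s) ≤ B := fun n =>
      exists_bound_of_isAdmissible (hreg n) (fun j hj => hmono hj) fun s hs _ => by
        split_ifs with h
        · exact (hreg n).ord_pos
        · exact hs ▸ hF s h
    choose B hB hle using this
    refine ⟨B, hB, fun s hs hns => ?_⟩
    have := hle s.length s rfl hs
    rwa [if_neg hns] at this
  -- The builder's t precedes α and depends only on the position, so γ can be fixed before β; W then
  -- bounds the replies to γ in every position, whatever was played before.
  obtain ⟨T, hT, hτT⟩ := hbound τ hτ
  obtain ⟨γ, hγ, m₁, hγT⟩ := hcof T hT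
  have hadd : ∀ β < c.ord, ∀ n, f β n + 1 < (l n).ord := fun β hβ n =>
    add_one_lt_ord (hreg n) (hmem β hβ n)
  obtain ⟨W, hW, hnxtW⟩ := hbound (fun s => nxt s (f γ s.length + 1))
    fun s hs => hlt s hs _ (hadd γ hγ _)
  obtain ⟨β, hβ, m₂, hβW⟩ := hcof W hW
  -- Even moves are pushed just above f γ and stay below f β; odd moves are pushed above f β, with
  -- ladders still bounded by f γ.
  let θ : ℕ → Ordinal.{u} := fun n => if Even n then f γ n + 1 else f β n + 1
  have hθ : ∀ n, θ n < (l n).ord := by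
    intro n
    simp only [θ]
    split_ifs
    · exact hadd γ hγ n
    · exact hadd β hβ n
  let p : ℕ → List Ordinal.{u} := fun n => Nat.rec [] (fun n s => nxt s (θ n) :: s) n
  have hp : ∀ n, p (n + 1) = nxt (p n) (θ n) :: p n := fun n => rfl
  have hlen : ∀ n, (p n).length = n := by
    intro n
    induction n with
    | zero => rfl
    | succ n ih => rw [hp, List.length_cons, ih]
  have hpl : ∀ n, ¬ IsLosing i l G δ (p n) := by
    intro n
    induction n with
    | zero => exact hwin
    | succ n ih => exact hnl _ ih _ ((hlen n).symm ▸ hθ n)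
  have hθ' : ∀ n, θ n < (l (p n).length).ord := fun n => (hlen n).symm ▸ hθ n
  have hvl : ∀ n, nxt (p n) (θ n) < (l n).ord := fun n => by
    have := hlt _ (hpl n) _ (hθ' n)
    rwa [hlen] at this
  have hadm : ∀ n, IsAdmissible l (p n) := by
    intro n
    induction n with
    | zero => trivial
    | succ n ih => exact ⟨hlt _ (hpl n) _ (hθ' n), ih⟩
  have hpA : ∀ n, ∀ a ∈ p n, a < c.ord := by
    intro n
    induction n with
    | zero => simp [p]
    | succ n ih =>
      intro a ha
      rw [hp] at ha
      rcases List.mem_cons.1 ha with rfl | ha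
      · exact (hvl n).trans_le (Cardinal.ord_le_ord.2 (hlc n))
      · exact ih a ha
  let X : ℕ → Set Ordinal.{u} := fun n => Iio δ ∪ {a | a ∈ p n}
  have hX : Monotone X := monotone_nat_of_le_succ fun n =>
    union_subset_union_right _ fun a ha => by
      rw [mem_ofPred_eq, hp]
      exact List.mem_cons_of_mem _ ha
  have hXdir : ∀ j k, ∃ n, X j ⊆ X n ∧ X k ⊆ X n := fun j k =>
    ⟨max j k, hX (le_max_left _ _), hX (le_max_right _ _)⟩
  have hωc : ω_ 1 ≤ c.ord := by
    rw [← Cardinal.ord_aleph]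
    exact Cardinal.ord_le_ord.2 ((hl 0).le.trans (hlc 0))
  let x := hull G (⋃ n, X n)
  have hδx : Iio δ ⊆ x := fun a ha => subset_hull (mem_iUnion.2 ⟨0, Or.inl ha⟩)
  have hvx : ∀ n, nxt (p n) (θ n) ∈ x := fun n =>
    subset_hull (mem_iUnion.2 ⟨n + 1, Or.inr (List.mem_cons_self)⟩)
  have hxA : x ⊆ Iio c.ord := hull_subset (iUnion_subset fun n => union_subset
    (fun a ha => (lt_trans ha hδ).trans_le hωc) (hpA n)) hGA
  have hxc : x.Countable := countable_hull hG <| countable_iUnion fun n =>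
    (countable_Iio_of_lt hδ).union (List.finite_toSet (p n)).countable
  have hxinf : x.Infinite := by
    refine Set.Infinite.mono ((Iio_subset_Iio hωδ).trans hδx) ?_
    refine infinite_of_injective_forall_mem (f := fun n : ℕ => (n : Ordinal.{u}))
      Nat.cast_injective fun n => natCast_lt_omega0 n
  have hxω : x ∩ Iio (ω_ 1) = Iio δ := by
    apply Subset.antisymm
    · rintro a ⟨hax, haω⟩
      obtain ⟨n, hn⟩ := mem_iUnion.1 (hull_iUnion_subset hXdir hax)
      exact isSafe_of_not_isLosing (hpl n) ⟨hn, haω⟩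
    · exact fun a ha => ⟨hδx ha, lt_trans ha hδ⟩
  refine ⟨x, ⟨⟨hxA, hxc, hxinf⟩, δ, hδ, hxω, γ, hγ, β, hβ, max m₁ m₂, fun n hn =>
    ⟨fun he => ?_, fun ho => ?_⟩⟩, hGC x hxA hxc hxinf.nonempty listClosed_hull⟩
  · have hθn : θ n = f γ n + 1 := if_pos he
    refine ⟨_, hvx n, ?_, ?_⟩
    · have := hge _ (hpl n) _ (hθ' n)
      rw [hθn] at this ⊢
      exact (lt_add_one _).trans_le this
    · have := hnxtW _ (hadm n) (hpl n)
      rw [hlen, ← hθn] at this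
      exact this.trans (hβW n (le_of_max_le_right hn)).le
  · have hθn : θ n = f β n + 1 := if_neg (Nat.not_even_iff_odd.2 ho)
    refine ⟨_, hvx n, hcofn _ (hpl n) _ (hθ' n), ?_, fun ξ hξ => ?_⟩
    · have := hge _ (hpl n) _ (hθ' n)
      rw [hθn] at this ⊢
      exact (lt_add_one _).trans_le this
    · have := hτT _ (hadm n) (hpl n)
      rw [hlen] at this
      exact (hbd _ (hpl n) _ (hθ' n) ξ hξ).trans
        (this.trans (hγT n (le_of_max_le_left hn)).le)

end Stationary

/-! ### Conclusion -/

theorem theorem4p1 (μ : Cardinal.{u}) (hsing : μ.IsSingular) (hcof : μ.ord.cof = ℵ₀)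
    (hSSR : SSR (Order.succ μ)) (l : ℕ → Cardinal.{u}) (hmono : StrictMono l)
    (hreg : ∀ n, (l n).IsRegular) (hsup : ⨆ n, l n = μ) :
    ¬ ∃ f : Ordinal.{u} → ℕ → Ordinal.{u}, IsBetterScale l f := by
  rintro ⟨f, ⟨hmem, hinc, hscale⟩, hbetter⟩
  rw [hsup] at hmem hinc hscale hbetter
  have hle : ∀ n, l n ≤ μ := fun n => hsup ▸ le_ciSup Cardinal.bddAbove_of_small n
  have hl₁ : ∀ n, ℵ₁ < l (n + 2) := fun n => by
    have h₁ : ℵ₁ ≤ l 1 := by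
      rw [← Cardinal.succ_aleph0, Order.succ_le_iff]
      exact (hreg 0).1.trans_lt (hmono Nat.zero_lt_one)
    exact h₁.trans_lt (hmono (by omega))
  have hc : (Order.succ μ).IsRegular := isRegular_succ hsing.aleph0_le
  have hc₁ : ℵ₁ < Order.succ μ := (hl₁ 0).trans_le ((hle 2).trans (Order.le_succ μ))
  obtain ⟨i, hi⟩ := exists_ladder
  -- Dropping two coordinates ensures that every remaining cardinal exceeds ℵ₁.
  let f' : Ordinal.{u} → ℕ → Ordinal.{u} := fun β n => f β (n + 2)
  have hshift : ∀ {m : ℕ} {g h : ℕ → Ordinal.{u}}, LtFrom m g h →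
      LtFrom m (fun n => g (n + 2)) fun n => h (n + 2) := fun H n hn => H _ (by omega)
  have hwit : ∀ α < (Order.succ μ).ord, ∃ σ, IsUniformWitness f' (Iio α) σ := fun α hα =>
    exists_isUniformWitness (fun a b hab hb => (hinc a b hab hb).imp fun m => hshift)
      (fun α hα hα' => by
        obtain ⟨C, σ, hC, hσ⟩ := hbetter α hα hα'
        exact ⟨C, σ, hC, fun β γ h => hshift (hσ β γ h)⟩) hα
  have hstat := isStationaryCountable_ladderSets (l := fun n => l (n + 2)) (f := f') hi
    (fun m n h => hmono (by omega)) (fun n => hreg _) hl₁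
    (fun n => (hle _).trans (Order.le_succ μ)) (fun β hβ n => hmem β hβ _) (fun g hg => by
      -- Padding g with two zeros transfers cofinality to the shifted product.
      obtain ⟨β, hβ, m, h⟩ := hscale (fun n => if n < 2 then 0 else g (n - 2)) fun n => by
        dsimp only
        split_ifs with hn
        · exact (hreg n).ord_pos
        · obtain ⟨k, rfl⟩ := Nat.exists_eq_add_of_le' (not_lt.1 hn)
          exact hg k
      refine ⟨β, hβ, m, fun n hn => ?_⟩
      have := h (n + 2) (by omega)
      simpa using this)
  obtain ⟨I, -, hI, hωI, hIstat⟩ := hSSR _ isFull_ladderSets hstat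
  exact not_isStationaryCountable_ladderSets hc hc₁ hwit hI hωI hIstat
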